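/- Let $G$ be a finite group and let $\alpha:G\times G\to\mathbb{C}$ be a unitary cocycle, i.e., $|\alpha(x,y)|=1$ and $\alpha(x,y)\alpha(xy,z)=\alpha(x,yz)\alpha(y,z)$ for all $x,y,z\in G$. A projective representation with cocycle $\alpha$ is a map $\rho:G\to\mathrm{GL}(\mathbb{C}^d)$ with $\rho(g)\rho(h)=\alpha(g,h)\rho(gh)$ for all $g,h\in G$. It is unitary if every $\rho(g)$ is unitary, and irreducible if $d\ge 1$ and its only invariant subspaces are $0$ and $\mathbb{C}^d$. Two of them are equivalent if they are conjugate, $\xi=T\rho T^{-1}$, by an invertible linear map $T$. Let $R$ be a complete set of irreducible unitary projective representations for $\alpha$: all its members are unitary and irreducible, and every irreducible projective representation with cocycle $\alpha$ is equivalent to exactly one of them. A normalised tight $(G,\alpha)$-frame is a sequence $(\phi_g)_{g\in G}=(\rho(g)v)_{g\in G}$, where $\rho$ is a unitary projective representation with cocycle $\alpha$ on some $\mathbb{C}^d$ and $0\ne v\in\mathbb{C}^d$, such that $f=\sum_{g\in G}\langle f,\phi_g\rangle\phi_g$ for all $f\in\mathbb{C}^d$ (with $\langle\cdot,\cdot\rangle$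 linear in the first argument). Its Gramian is the matrix in $\mathbb{C}^{G\times G}$ with $(g,h)$-entry $\langle\phi_h,\phi_g\rangle$. An orthogonal projection is a square complex matrix $Q$ with $Q^2=Q=Q^*$. For $\nu:G\to\mathbb{C}$ let $P=M_\alpha(\nu)\in\mathbb{C}^{G\times G}$ be the $(G,\alpha)$-matrix with entries $$P_{g,h}=\frac{\nu(g^{-1}h)}{\alpha(g,g^{-1}h)},$$ and for $\rho\in R$ let $$(F_\alpha\nu)_\rho=\sum_{a\in G}\frac{\nu(a)\,\rho(a^{-1})}{\alpha(a,a^{-1})\,\alpha(1,1)}.$$ Then: 1. $P$ is the Gramian of a normalised tight $(G,\alpha)$-frame if and only if $P\neq 0$ and $P$ is an orthogonal projection. 2. $P$ is an orthogonal projection if and only if $(F_\alpha\nu)_\rho$ is an orthogonal projection for every $\rho\in R$. In particular, if $P\ne 0$, the following are equivalent: $P$ is the Gramian of a normalised tight $(G,\alpha)$-frame; $P$ is an orthogonal projection; every Fourier coefficient $(F_\alpha\nu)_\rho$, $\rho\in R$, is an orthogonal projection. -/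

import Mathlib

open scoped Matrix

noncomputable section

/-- A unitary `2`-cocycle `α : G × G → ℂ` of the group `G`. -/
structure IsUnitaryCocycle {G : Type*} [Group G] (α : G → G → ℂ) : Prop where
  mul_rule : ∀ x y z : G, α x y * α (x * y) z = α x (y * z) * α y z
  norm_eq_one : ∀ x y : G, ‖α x y‖ = 1

/-- The `(G,α)`-matrix `M_α(ν) ∈ ℂ^{G × G}` determined by `ν : G → ℂ`. -/
def cocycleMatrix {G : Type*} [Group G] (α : G → G → ℂ) (ν : G → ℂ) : Matrix G G ℂ :=
  Matrix.of fun g h => ν (g⁻¹ * h) / α g (g⁻¹ * h)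

/-- A projective representation `ρ : G → GL(ℂ^d)` with cocycle `α`. -/
structure ProjRep {G : Type*} [Group G] (α : G → G → ℂ) where
  /-- the dimension `d` -/
  dim : ℕ
  /-- the underlying map `G → GL(ℂ^d)` -/
  toGL : G → GL (Fin dim) ℂ
  mul_eq : ∀ g h : G,
    (toGL g : Matrix (Fin dim) (Fin dim) ℂ) * (toGL h : Matrix (Fin dim) (Fin dim) ℂ) =
      α g h • (toGL (g * h) : Matrix (Fin dim) (Fin dim) ℂ)

namespace ProjRep

variable {G : Type*} [Group G] {α : G → G → ℂ}

/-- The matrix of `ρ(g)`. -/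
def mat (ρ : ProjRep α) (g : G) : Matrix (Fin ρ.dim) (Fin ρ.dim) ℂ := (ρ.toGL g).val

/-- `ρ` is unitary: every `ρ(g)` is a unitary matrix. -/
def IsUnitary (ρ : ProjRep α) : Prop :=
  ∀ g : G, ρ.mat g ∈ Matrix.unitaryGroup (Fin ρ.dim) ℂ

/-- `ρ` is irreducible: it acts on a nonzero space, and the only invariant subspaces are `0` and
the whole space. -/
def IsIrreducible (ρ : ProjRep α) : Prop :=
  ρ.dim ≠ 0 ∧ ∀ W : Submodule ℂ (Fin ρ.dim → ℂ),
    (∀ g : G, ∀ w ∈ W, ρ.mat g *ᵥ w ∈ W) → W = ⊥ ∨ W = ⊤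

/-- Equivalence of projective representations for the same (fixed) cocycle: `ξ = T ρ T⁻¹` for an
invertible linear map `T`. -/
def Equivalent (ρ ξ : ProjRep α) : Prop :=
  ∃ T : (Fin ρ.dim → ℂ) ≃ₗ[ℂ] (Fin ξ.dim → ℂ),
    ∀ (g : G) (w : Fin ρ.dim → ℂ), T (ρ.mat g *ᵥ w) = ξ.mat g *ᵥ T w

/-- `R` is a complete set of irreducible representations for `α`: all its members are irreducible,
and every irreducible representation for `α` is equivalent to exactly one member of `R`. -/
def IsCompleteSet (R : Set (ProjRep α)) : Prop :=
  (∀ ρ ∈ R, ρ.IsIrreducible) ∧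
    ∀ ξ : ProjRep α, ξ.IsIrreducible → ∃! ρ : ProjRep α, ρ ∈ R ∧ ξ.Equivalent ρ

/-- The Fourier coefficient `(F_α f)_ρ = ∑ₐ f(a) ρ(a⁻¹) / (α(a,a⁻¹) α(1,1))`. -/
def fourier [Fintype G] (f : G → ℂ) (ρ : ProjRep α) : Matrix (Fin ρ.dim) (Fin ρ.dim) ℂ :=
  ∑ a : G, (f a / (α a a⁻¹ * α 1 1)) • ρ.mat a⁻¹

/-- The projective orbit `(ρ(g) v)_{g ∈ G}` in the Euclidean space `ℂ^d`. -/
def orbit (ρ : ProjRep α) (v : EuclideanSpace ℂ (Fin ρ.dim)) (g : G) :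
    EuclideanSpace ℂ (Fin ρ.dim) :=
  WithLp.toLp 2 (ρ.mat g *ᵥ v.ofLp)

end ProjRep

/-- A finite normalised tight frame (Parseval frame) `(φ_j)` for `ℂ^d`: `f = ∑_j ⟨f, φ_j⟩ φ_j` for
all `f`. (Mathlib's inner product is conjugate-linear in the first argument, so the coefficient
that is linear in `f` is `inner ℂ (φ j) f`.) -/
def IsNormalisedTightFrame {ι : Type*} [Fintype ι] {d : ℕ}
    (φ : ι → EuclideanSpace ℂ (Fin d)) : Prop :=
  ∀ f : EuclideanSpace ℂ (Fin d), f = ∑ j, inner ℂ (φ j) f • φ j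

/-- `P` is the Gramian of a normalised tight `(G,α)`-frame: there are a unitary projective
representation `ρ` with cocycle `α` on some `ℂ^d` and a nonzero `v ∈ ℂ^d` such that
`(ρ(g)v)_{g ∈ G}` is a normalised tight frame for `ℂ^d` whose Gramian, with `(g,h)` entry
`(ρ(g)v)* (ρ(h)v)`, is `P`. -/
def IsGramianOfTightFrame {G : Type*} [Group G] [Fintype G] (α : G → G → ℂ)
    (P : Matrix G G ℂ) : Prop :=
  ∃ (ρ : ProjRep α) (v : EuclideanSpace ℂ (Fin ρ.dim)),
    ρ.IsUnitary ∧ v ≠ 0 ∧ IsNormalisedTightFrame (ρ.orbit v) ∧ P = Matrix.gram ℂ (ρ.orbit v)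

end

/-! Everything takes place in the twisted group algebra. The map `cocycleMatrix α` is injective and
turns `twistedConv` and `twistedStar` into matrix product and adjoint; on unitary `ρ`, the map
`ρ.fourier` respects the same star and reverses products, which is harmless for a square. So both
projection conditions say `ν ⋆ ν = ν` and `ν* = ν`, once Fourier coefficients over `R` determine
`ν`. This is `IsCompleteSet.eq_zero`: by complete reducibility, a combination of operators that
vanishes on all of `R` vanishes in the regular representation, where it is tested on the delta at
`1`.

For frames, the reconstruction formula makes a Gramian idempotent. Conversely a projection `P`
commutes with the regular representation, which therefore restricts to the range of `P`; the vectors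
`P e_g` form an orbit there, a Parseval frame with Gramian `P`. -/

open scoped InnerProductSpace

namespace IsUnitaryCocycle

variable {G : Type*} [Group G] {α : G → G → ℂ}

lemma ne_zero (hα : IsUnitaryCocycle α) (x y : G) : α x y ≠ 0 := by
  intro h
  have := hα.norm_eq_one x y
  simp [h] at this

lemma one_right (hα : IsUnitaryCocycle α) (x : G) : α x 1 = α 1 1 := by
  have h := hα.mul_rule x 1 1
  simp only [mul_one] at h
  exact mul_left_cancel₀ (hα.ne_zero x 1) h

lemma conj_eq_inv (hα : IsUnitaryCocycle α) (x y : G) : starRingEnd ℂ (α x y) = (α x y)⁻¹ :=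
  (Complex.inv_eq_conj (hα.norm_eq_one x y)).symm

end IsUnitaryCocycle

/-! ### Projective representations: inverses and coordinates -/

namespace ProjRep

variable {G : Type*} [Group G] {α : G → G → ℂ}

lemma mat_mul (ρ : ProjRep α) (g h : G) : ρ.mat g * ρ.mat h = α g h • ρ.mat (g * h) :=
  ρ.mul_eq g h

lemma isUnit_mat (ρ : ProjRep α) (g : G) : IsUnit (ρ.mat g) := (ρ.toGL g).isUnit

lemma mat_one (ρ : ProjRep α) : ρ.mat 1 = α 1 1 • 1 := by
  have h := ρ.mat_mul 1 1
  rw [mul_one] at h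
  apply (ρ.isUnit_mat 1).mul_left_cancel
  rw [h, mul_smul_comm, mul_one]

lemma mat_mul_mat_inv (ρ : ProjRep α) (g : G) :
    ρ.mat g * ρ.mat g⁻¹ = (α g g⁻¹ * α 1 1) • 1 := by
  rw [ρ.mat_mul, mul_inv_cancel, ρ.mat_one, smul_smul]

lemma mat_inv (hα : IsUnitaryCocycle α) (ρ : ProjRep α) (g : G) :
    (ρ.mat g)⁻¹ = (α g g⁻¹ * α 1 1)⁻¹ • ρ.mat g⁻¹ := by
  apply Matrix.inv_eq_right_inv
  rw [mul_smul_comm, ρ.mat_mul_mat_inv, inv_smul_smul₀]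
  exact mul_ne_zero (hα.ne_zero _ _) (hα.ne_zero _ _)

lemma mat_inv_mul_mat_inv (hα : IsUnitaryCocycle α) (ρ : ProjRep α) (g h : G) :
    (ρ.mat g)⁻¹ * (ρ.mat h)⁻¹ = (α h g)⁻¹ • (ρ.mat (h * g))⁻¹ := by
  rw [← Matrix.mul_inv_rev, ρ.mat_mul]
  apply Matrix.inv_eq_right_inv
  have hu : IsUnit (ρ.mat (h * g)).det := (Matrix.isUnit_iff_isUnit_det _).1 (ρ.isUnit_mat _)
  rw [mul_smul_comm, smul_mul_assoc, Matrix.mul_nonsing_inv _ hu,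
    inv_smul_smul₀ (hα.ne_zero _ _)]

lemma IsUnitary.inv_eq_conjTranspose {ρ : ProjRep α} (hρ : ρ.IsUnitary) (g : G) :
    (ρ.mat g)⁻¹ = (ρ.mat g)ᴴ :=
  Matrix.inv_eq_right_inv (Matrix.mem_unitaryGroup_iff.1 (hρ g))

/-- The projective representation, in coordinates, given by operators on a vector space with a
basis. -/
noncomputable def ofBasis {V : Type*} [AddCommGroup V] [Module ℂ V] (hα : IsUnitaryCocycle α) {n : ℕ}
    (b : Module.Basis (Fin n) ℂ V) (T : G → V →ₗ[ℂ] V)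
    (hT : ∀ g h x, T g (T h x) = α g h • T (g * h) x) (h1 : ∀ x, T 1 x = α 1 1 • x) :
    ProjRep α where
  dim := n
  toGL g :=
    have key (g : G) : LinearMap.toMatrix b b (T g) *
        ((α g g⁻¹ * α 1 1)⁻¹ • LinearMap.toMatrix b b (T g⁻¹)) = 1 := by
      rw [← map_smul, ← LinearMap.toMatrix_comp b b b, ← LinearMap.toMatrix_id b]
      congr 1
      ext x
      have h0 : α g g⁻¹ * α 1 1 ≠ 0 := mul_ne_zero (hα.ne_zero _ _) (hα.ne_zero _ _)
      simp only [LinearMap.comp_apply, LinearMap.smul_apply, map_smul, hT, mul_inv_cancel, h1,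
        smul_smul, LinearMap.id_apply]
      rw [inv_mul_cancel₀ h0, one_smul]
    ⟨LinearMap.toMatrix b b (T g), (α g g⁻¹ * α 1 1)⁻¹ • LinearMap.toMatrix b b (T g⁻¹),
      key g, mul_eq_one_comm.1 (key g)⟩
  mul_eq g h := by
    simp only
    rw [← LinearMap.toMatrix_comp b b b, ← map_smul]
    congr 1
    ext x
    simp [hT]

lemma ofBasis_mat_mulVec {V : Type*} [AddCommGroup V] [Module ℂ V] (hα : IsUnitaryCocycle α)
    {n : ℕ} (b : Module.Basis (Fin n) ℂ V) (T : G → V →ₗ[ℂ] V)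
    (hT : ∀ g h x, T g (T h x) = α g h • T (g * h) x) (h1 : ∀ x, T 1 x = α 1 1 • x)
    (g : G) (x : V) :
    (ofBasis hα b T hT h1).mat g *ᵥ (b.repr x : Fin n → ℂ) = b.repr (T g x) :=
  LinearMap.toMatrix_mulVec_repr b b (T g) x

lemma ofBasis_isUnitary {V : Type*} [NormedAddCommGroup V] [InnerProductSpace ℂ V]
    (hα : IsUnitaryCocycle α) {n : ℕ} (b : OrthonormalBasis (Fin n) ℂ V) (T : G → V →ₗ[ℂ] V)
    (hT : ∀ g h x, T g (T h x) = α g h • T (g * h) x) (h1 : ∀ x, T 1 x = α 1 1 • x)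
    (hiso : ∀ g (x y : V), inner ℂ (T g x) (T g y) = inner ℂ x y) :
    (ofBasis hα b.toBasis T hT h1).IsUnitary := by
  intro g
  rw [Matrix.mem_unitaryGroup_iff']
  ext (i : Fin n) (j : Fin n)
  have hentry (k l : Fin n) :
      LinearMap.toMatrix b.toBasis b.toBasis (T g) k l = ⟪b k, T g (b l)⟫_ℂ := by
    rw [LinearMap.toMatrix_apply, OrthonormalBasis.coe_toBasis,
      OrthonormalBasis.coe_toBasis_repr_apply, OrthonormalBasis.repr_apply_apply]
  have := b.sum_inner_mul_inner (T g (b i)) (T g (b j))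
  rw [hiso, orthonormal_iff_ite.1 b.orthonormal i j] at this
  refine Eq.trans ?_ (this.trans Matrix.one_apply.symm)
  refine Finset.sum_congr (s₁ := (Finset.univ : Finset (Fin n))) rfl fun k _ => ?_
  rw [← inner_conj_symm (T g (b i)) (b k), ← hentry, ← hentry]
  rfl

/-! ### Complete reducibility for isometric projective actions -/

section Invariant

variable {E : Type*} [NormedAddCommGroup E] [InnerProductSpace ℂ E]
  {T : G → E →ₗ[ℂ] E}

lemma apply_one_of_isometry (hT : ∀ g h x, T g (T h x) = α g h • T (g * h) x)
    (hiso : ∀ g (x y : E), inner ℂ (T g x) (T g y) = inner ℂ x y) (x : E) : T 1 x = α 1 1 • x := by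
  have h := hT 1 1 x
  rw [mul_one, ← map_smul, ← sub_eq_zero, ← map_sub] at h
  rw [← sub_eq_zero, ← inner_self_eq_zero (𝕜 := ℂ), ← hiso 1, h, inner_zero_left]

/-- Each `u ∈ U` is `T g` of a multiple of `T g⁻¹ u`, again in `U`, so the isometry `T g` can be
cancelled from the inner product. -/
lemma orthogonal_invariant (hα : IsUnitaryCocycle α)
    (hT : ∀ g h x, T g (T h x) = α g h • T (g * h) x)
    (hiso : ∀ g (x y : E), inner ℂ (T g x) (T g y) = inner ℂ x y) {U : Submodule ℂ E}
    (hU : ∀ g, ∀ u ∈ U, T g u ∈ U) (g : G) (w : E) (hw : w ∈ Uᗮ) : T g w ∈ Uᗮ := by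
  rw [Submodule.mem_orthogonal] at hw ⊢
  intro u hu
  have hu' : T g ((α g g⁻¹ * α 1 1)⁻¹ • T g⁻¹ u) = u := by
    rw [map_smul, hT, mul_inv_cancel, apply_one_of_isometry hT hiso, smul_smul, smul_smul,
      mul_assoc, inv_mul_cancel₀, one_smul]
    exact mul_ne_zero (hα.ne_zero _ _) (hα.ne_zero _ _)
  rw [← hu', hiso]
  exact hw _ (U.smul_mem _ (hU _ _ hu))

/-- A linear combination of the operators which vanishes in all members of a complete set of
irreducible representations vanishes on invariant subspaces of unitary ones. -/
lemma sum_smul_apply_eq_zero [Fintype G] [FiniteDimensional ℂ E] (hα : IsUnitaryCocycle α)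
    {R : Set (ProjRep α)} (hR : IsCompleteSet R) {c : G → ℂ}
    (hc : ∀ ρ ∈ R, ∑ a, c a • ρ.mat a = 0)
    (hT : ∀ g h x, T g (T h x) = α g h • T (g * h) x)
    (hiso : ∀ g (x y : E), inner ℂ (T g x) (T g y) = inner ℂ x y) (n : ℕ) :
    ∀ W : Submodule ℂ E, Module.finrank ℂ W = n → (∀ g, ∀ w ∈ W, T g w ∈ W) →
      ∀ w ∈ W, ∑ a, c a • T a w = 0 := by
  induction n using Nat.strong_induction_on with
  | _ n ih =>
  intro W hn hW w hw
  by_cases hsimple : ∃ U : Submodule ℂ E, U < W ∧ U ≠ ⊥ ∧ ∀ g, ∀ u ∈ U, T g u ∈ U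
  -- `W` is the sum of `U` and `Uᗮ ⊓ W`, both invariant and of smaller dimension.
  · obtain ⟨U, hUW, hU0, hU⟩ := hsimple
    have hUinv := orthogonal_invariant hα hT hiso hU
    have hlt : Uᗮ ⊓ W < W := by
      refine lt_of_le_of_ne inf_le_right fun h => hU0 ?_
      have : W ≤ Uᗮ := inf_eq_right.1 h
      rw [eq_bot_iff, ← U.inf_orthogonal_eq_bot]
      exact le_inf le_rfl (hUW.le.trans this)
    have hw' := hw
    rw [← Submodule.sup_orthogonal_inf_of_hasOrthogonalProjection hUW.le,
      Submodule.mem_sup] at hw'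
    obtain ⟨y, hy, z, hz, rfl⟩ := hw'
    have h1 := ih _ (hn ▸ Submodule.finrank_lt_finrank_of_lt hUW) U rfl hU y hy
    have h2 := ih _ (hn ▸ Submodule.finrank_lt_finrank_of_lt hlt) _ rfl
      (fun g u hu => Submodule.mem_inf.2 ⟨hUinv g u hu.1, hW g u hu.2⟩) z hz
    simp only [map_add, smul_add, Finset.sum_add_distrib, h1, h2, add_zero]
  · by_cases hW0 : W = ⊥
    · subst hW0
      rw [Submodule.mem_bot] at hw
      simp [hw]
    push Not at hsimple
    -- With no proper nonzero invariant subspace left, `W` in coordinates is irreducible, hence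
    -- equivalent to a member of `R`.
    let b := Module.finBasis ℂ W
    let S : G → W →ₗ[ℂ] W := fun g => (T g).restrict (hW g)
    have hS : ∀ g h x, S g (S h x) = α g h • S (g * h) x := fun g h x =>
      Subtype.ext (hT g h x)
    have hS1 : ∀ x, S 1 x = α 1 1 • x := fun x =>
      Subtype.ext (apply_one_of_isometry hT hiso x)
    let ξ := ofBasis hα b S hS hS1
    have hξ (g : G) (x : W) : ξ.mat g *ᵥ b.equivFun x = b.equivFun (S g x) :=
      ofBasis_mat_mulVec hα b S hS hS1 g x
    have hirr : ξ.IsIrreducible := by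
      refine ⟨fun h => hW0 (Submodule.finrank_eq_zero.1 h),
        fun (V : Submodule ℂ (Fin (Module.finrank ℂ W) → ℂ)) hV => ?_⟩
      change V = ⊥ ∨ V = ⊤
      let U : Submodule ℂ W := V.comap b.equivFun.toLinearMap
      have hmem (x : W) : x ∈ U ↔ b.equivFun x ∈ V := Iff.rfl
      have hUinv : ∀ g, ∀ u ∈ U.map W.subtype, T g u ∈ U.map W.subtype := by
        rintro g _ ⟨u, hu, rfl⟩
        refine ⟨S g u, ?_, rfl⟩
        have := hV g _ ((hmem u).1 hu)
        exact (hmem _).2 ((hξ g u) ▸ this)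
      have hUW : U.map W.subtype ≤ W := Submodule.map_subtype_le W U
      have hVU : V = U.map b.equivFun.toLinearMap :=
        (Submodule.map_comap_eq_of_surjective b.equivFun.surjective V).symm
      rcases hUW.lt_or_eq with hlt | heq
      · left
        by_contra hV0
        obtain ⟨g, u, hu, hgu⟩ := hsimple _ hlt fun h0 => hV0 (by
          have : U = ⊥ := by
            apply Submodule.map_injective_of_injective W.injective_subtype
            rw [h0, Submodule.map_bot]
          rw [hVU, this, Submodule.map_bot])
        exact hgu (hUinv g u hu)
      · right
        have : U = ⊤ := by
          apply Submodule.map_injective_of_injective W.injective_subtype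
          rw [heq, Submodule.map_subtype_top]
        rw [hVU, this, Submodule.map_top]
        exact LinearEquiv.range _
    obtain ⟨ρ, ⟨hρR, e', he'⟩, -⟩ := hR.2 ξ hirr
    let e : (Fin (Module.finrank ℂ W) → ℂ) ≃ₗ[ℂ] (Fin ρ.dim → ℂ) := e'
    have he (g : G) (x : W) : e (b.equivFun (S g x)) = ρ.mat g *ᵥ e (b.equivFun x) :=
      (congrArg e' (hξ g x).symm).trans (he' g _)
    have key : e (b.equivFun (∑ a, c a • S a ⟨w, hw⟩)) = 0 := by
      have h0 := congrArg (· *ᵥ e (b.equivFun ⟨w, hw⟩)) (hc ρ hρR)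
      simp only [Matrix.sum_mulVec, Matrix.smul_mulVec, Matrix.zero_mulVec] at h0
      simp only [map_sum, map_smul, he, h0]
    have := b.equivFun.map_eq_zero_iff.1 (e.map_eq_zero_iff.1 key)
    have := congrArg W.subtype this
    simpa [S, map_sum] using this

end Invariant

/-! ### The regular representation -/

/-- The left regular projective representation for `α`, as operators on `ℂ^G`. -/
def regular [Fintype G] (α : G → G → ℂ) (g : G) :
    EuclideanSpace ℂ G →ₗ[ℂ] EuclideanSpace ℂ G where
  toFun f := WithLp.toLp 2 fun x => α g (g⁻¹ * x) * f (g⁻¹ * x)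
  map_add' f f' := by ext x; simp [mul_add]
  map_smul' r f := by ext x; simp [mul_left_comm]

lemma regular_apply [Fintype G] (g : G) (f : EuclideanSpace ℂ G) (x : G) :
    regular α g f x = α g (g⁻¹ * x) * f (g⁻¹ * x) := rfl

lemma regular_regular [Fintype G] (hα : IsUnitaryCocycle α) (g h : G)
    (f : EuclideanSpace ℂ G) :
    regular α g (regular α h f) = α g h • regular α (g * h) f := by
  ext x
  have := hα.mul_rule g h (h⁻¹ * (g⁻¹ * x))
  rw [mul_inv_cancel_left] at this
  simp only [regular_apply, PiLp.smul_apply, smul_eq_mul, mul_inv_rev, mul_assoc]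
  rw [← mul_assoc, ← this, mul_assoc]

lemma inner_regular [Fintype G] (hα : IsUnitaryCocycle α) (g : G) (f f' : EuclideanSpace ℂ G) :
    ⟪regular α g f, regular α g f'⟫_ℂ = ⟪f, f'⟫_ℂ := by
  simp only [PiLp.inner_apply, regular_apply, RCLike.inner_apply, map_mul]
  rw [← Equiv.sum_comp (Equiv.mulLeft g)]
  refine Finset.sum_congr rfl fun x _ => ?_
  simp only [Equiv.coe_mulLeft, inv_mul_cancel_left, hα.conj_eq_inv]
  field_simp [hα.ne_zero]

lemma regular_single_one [Fintype G] [DecidableEq G] (hα : IsUnitaryCocycle α) (g : G) :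
    regular α g (EuclideanSpace.single 1 1) = α 1 1 • EuclideanSpace.single g 1 := by
  ext x
  simp only [regular_apply, PiLp.single_apply, PiLp.smul_apply, smul_eq_mul,
    inv_mul_eq_one, eq_comm (a := g)]
  split_ifs with h
  · subst h
    simp [hα.one_right]
  · simp

/-- The members of a complete set of irreducible representations separate the twisted group
algebra. -/
lemma IsCompleteSet.eq_zero [Fintype G] (hα : IsUnitaryCocycle α)
    {R : Set (ProjRep α)} (hR : IsCompleteSet R) {c : G → ℂ}
    (hc : ∀ ρ ∈ R, ∑ a, c a • ρ.mat a = 0) : c = 0 := by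
  classical
  -- On the delta at `1` the combination has `a`-coordinate `c a * α 1 1`.
  have h := sum_smul_apply_eq_zero hα hR hc (regular_regular hα) (inner_regular hα) _ ⊤ rfl
    (fun _ _ _ => Submodule.mem_top) (EuclideanSpace.single 1 1) Submodule.mem_top
  funext a
  have ha := congrArg (fun f : EuclideanSpace ℂ G => f a) h
  simpa [regular_single_one hα, hα.ne_zero, Pi.single_apply] using ha

end ProjRep

/-! ### The twisted group algebra and its Fourier transform -/

section TwistedConvolution

variable {G : Type*} [Group G] {α : G → G → ℂ}

/-- The convolution of the twisted group algebra of `(G,α)`-matrices. -/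
noncomputable def twistedConv [Fintype G] (α : G → G → ℂ) (μ ν : G → ℂ) (c : G) : ℂ :=
  ∑ a : G, μ a * ν (a⁻¹ * c) / α a (a⁻¹ * c)

/-- The involution of the twisted group algebra of `(G,α)`-matrices. -/
noncomputable def twistedStar (α : G → G → ℂ) (ν : G → ℂ) (a : G) : ℂ :=
  starRingEnd ℂ (ν a⁻¹) * (α a a⁻¹ * α 1 1)

lemma cocycleMatrix_mul [Fintype G] (hα : IsUnitaryCocycle α) (μ ν : G → ℂ) :
    cocycleMatrix α μ * cocycleMatrix α ν = cocycleMatrix α (twistedConv α μ ν) := by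
  ext g h
  simp only [Matrix.mul_apply, cocycleMatrix, Matrix.of_apply, twistedConv, Finset.sum_div]
  rw [← Equiv.sum_comp (Equiv.mulLeft g)]
  refine Finset.sum_congr rfl fun a _ => ?_
  have := hα.mul_rule g a (a⁻¹ * (g⁻¹ * h))
  simp only [Equiv.coe_mulLeft, inv_mul_cancel_left, mul_inv_rev, mul_assoc] at this ⊢
  rw [mul_inv_cancel_left] at this
  rw [div_mul_div_comm, this, div_div, mul_comm (α g _)]

lemma conjTranspose_cocycleMatrix (hα : IsUnitaryCocycle α) (ν : G → ℂ) :
    (cocycleMatrix α ν)ᴴ = cocycleMatrix α (twistedStar α ν) := by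
  ext g h
  have := hα.mul_rule g (g⁻¹ * h) (h⁻¹ * g)
  have h2 : g⁻¹ * h * (h⁻¹ * g) = 1 := by group
  rw [mul_inv_cancel_left, h2, hα.one_right] at this
  simp only [Matrix.conjTranspose_apply, cocycleMatrix, Matrix.of_apply, twistedStar,
    mul_inv_rev, inv_inv, star_div₀, RCLike.star_def, hα.conj_eq_inv]
  have e1 := hα.ne_zero g (g⁻¹ * h)
  have e2 := hα.ne_zero h (h⁻¹ * g)
  field_simp
  linear_combination (starRingEnd ℂ (ν (h⁻¹ * g))) * this

lemma cocycleMatrix_injective (hα : IsUnitaryCocycle α) :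
    Function.Injective (cocycleMatrix α) := by
  intro μ ν h
  funext a
  have := congrFun (congrFun h 1) a
  simpa [cocycleMatrix, hα.ne_zero, div_left_inj'] using this

namespace ProjRep

variable [Fintype G]

/-- The normalising scalars are exactly those that turn `ρ(a⁻¹)` into `ρ(a)⁻¹`. -/
lemma fourier_eq_sum_inv (hα : IsUnitaryCocycle α) (f : G → ℂ) (ρ : ProjRep α) :
    ρ.fourier f = ∑ a, f a • (ρ.mat a)⁻¹ := by
  refine Finset.sum_congr rfl fun a _ => ?_
  rw [ρ.mat_inv hα, smul_smul, div_eq_mul_inv]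

lemma fourier_mul (hα : IsUnitaryCocycle α) (μ ν : G → ℂ) (ρ : ProjRep α) :
    ρ.fourier ν * ρ.fourier μ = ρ.fourier (twistedConv α μ ν) := by
  simp only [fourier_eq_sum_inv hα, twistedConv, Finset.sum_smul, Finset.mul_sum,
    Finset.sum_mul]
  rw [Finset.sum_comm (f := fun c a => (μ a * ν (a⁻¹ * c) / α a (a⁻¹ * c)) • (ρ.mat c)⁻¹)]
  refine Finset.sum_congr rfl fun a _ => ?_
  conv_rhs => rw [← Equiv.sum_comp (Equiv.mulLeft a)]
  refine Finset.sum_congr rfl fun b _ => ?_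
  simp only [Equiv.coe_mulLeft, inv_mul_cancel_left]
  rw [smul_mul_smul_comm, ρ.mat_inv_mul_mat_inv hα, smul_smul, mul_comm (ν b), div_eq_mul_inv]

lemma conjTranspose_fourier (hα : IsUnitaryCocycle α) (ν : G → ℂ) {ρ : ProjRep α}
    (hρ : ρ.IsUnitary) : (ρ.fourier ν)ᴴ = ρ.fourier (twistedStar α ν) := by
  rw [fourier_eq_sum_inv hα, Matrix.conjTranspose_sum]
  simp only [fourier, twistedStar]
  rw [← Equiv.sum_comp (Equiv.inv G)]
  refine Finset.sum_congr rfl fun a _ => ?_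
  rw [Matrix.conjTranspose_smul, hρ.inv_eq_conjTranspose, Matrix.conjTranspose_conjTranspose,
    mul_div_cancel_right₀ _ (mul_ne_zero (hα.ne_zero _ _) (hα.ne_zero _ _))]
  rfl

lemma IsCompleteSet.fourier_ext (hα : IsUnitaryCocycle α) {R : Set (ProjRep α)}
    (hR : IsCompleteSet R) {μ ν : G → ℂ} (h : ∀ ρ ∈ R, ρ.fourier μ = ρ.fourier ν) : μ = ν := by
  have hα0 (a : G) : α a⁻¹ a * α 1 1 ≠ 0 := mul_ne_zero (hα.ne_zero _ _) (hα.ne_zero _ _)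
  -- These are the coefficients of `ρ(a)` in the difference of the two transforms, after `a ↦ a⁻¹`.
  have h0 := hR.eq_zero hα (c := fun a => (μ a⁻¹ - ν a⁻¹) / (α a⁻¹ a * α 1 1)) fun ρ hρ => by
    have := sub_eq_zero.2 (h ρ hρ)
    rw [fourier, fourier, ← Finset.sum_sub_distrib] at this
    rw [← Equiv.sum_comp (Equiv.inv G), ← this]
    refine Finset.sum_congr rfl fun a _ => ?_
    simp only [Equiv.inv_apply, inv_inv, ← sub_smul, sub_div]
  funext a
  have ha := congrFun h0 a⁻¹
  simp only [inv_inv, Pi.zero_apply, div_eq_zero_iff] at ha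
  refine sub_eq_zero.1 (ha.resolve_right ?_)
  simpa using hα0 a⁻¹

end ProjRep

lemma isStarProjection_cocycleMatrix_iff [Fintype G] (hα : IsUnitaryCocycle α) (ν : G → ℂ) :
    IsStarProjection (cocycleMatrix α ν) ↔ twistedConv α ν ν = ν ∧ twistedStar α ν = ν := by
  rw [isStarProjection_iff, IsIdempotentElem, isSelfAdjoint_iff, Matrix.star_eq_conjTranspose,
    cocycleMatrix_mul hα, conjTranspose_cocycleMatrix hα, (cocycleMatrix_injective hα).eq_iff,
    (cocycleMatrix_injective hα).eq_iff]

lemma forall_isStarProjection_fourier_iff [Fintype G] (hα : IsUnitaryCocycle α) {R : Set (ProjRep α)}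
    (hR : ProjRep.IsCompleteSet R) (hRu : ∀ ρ ∈ R, ρ.IsUnitary) (ν : G → ℂ) :
    (∀ ρ ∈ R, IsStarProjection (ρ.fourier ν)) ↔
      twistedConv α ν ν = ν ∧ twistedStar α ν = ν := by
  constructor
  · intro h
    refine ⟨hR.fourier_ext hα fun ρ hρ => ?_, hR.fourier_ext hα fun ρ hρ => ?_⟩
    · rw [← ρ.fourier_mul hα]
      exact (h ρ hρ).isIdempotentElem
    · rw [← ρ.conjTranspose_fourier hα ν (hRu ρ hρ)]
      exact (h ρ hρ).isSelfAdjoint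
  · rintro ⟨h1, h2⟩ ρ hρ
    refine ⟨?_, ?_⟩
    · rw [IsIdempotentElem, ρ.fourier_mul hα, h1]
    · rw [isSelfAdjoint_iff, Matrix.star_eq_conjTranspose,
        ρ.conjTranspose_fourier hα ν (hRu ρ hρ), h2]

end TwistedConvolution

/-! ### Gramians of tight frames -/

section Gramian

variable {G : Type*} [Group G] [Fintype G] {α : G → G → ℂ}

lemma IsNormalisedTightFrame.isStarProjection_gram {ι : Type*} [Fintype ι] {d : ℕ}
    {φ : ι → EuclideanSpace ℂ (Fin d)} (h : IsNormalisedTightFrame φ) :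
    IsStarProjection (Matrix.gram ℂ φ) := by
  refine ⟨?_, ?_⟩
  · ext i j
    rw [Matrix.mul_apply]
    simp only [Matrix.gram_apply]
    -- Idempotence is the reconstruction formula for `φ j` paired with `φ i`.
    conv_rhs => rw [h (φ j), inner_sum]
    refine Finset.sum_congr rfl fun k _ => ?_
    rw [inner_smul_right, mul_comm]
  · exact Matrix.isHermitian_gram ℂ φ

lemma IsGramianOfTightFrame.ne_zero {P : Matrix G G ℂ} (h : IsGramianOfTightFrame α P) :
    P ≠ 0 := by
  obtain ⟨ρ, v, -, hv, -, rfl⟩ := h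
  intro h0
  have h1 := congrFun (congrFun h0 1) 1
  rw [Matrix.gram_apply, Matrix.zero_apply, inner_self_eq_zero] at h1
  have h2 : ρ.mat 1 *ᵥ v.ofLp = 0 := congrArg WithLp.ofLp h1
  apply hv
  ext i
  have := congrFun (Matrix.mulVec_injective_of_isUnit (ρ.isUnit_mat 1)
    (h2.trans (Matrix.mulVec_zero _).symm)) i
  simpa using this

lemma regular_toEuclideanLin_cocycleMatrix [DecidableEq G] (hα : IsUnitaryCocycle α)
    (ν : G → ℂ) (g : G) (f : EuclideanSpace ℂ G) :
    ProjRep.regular α g (Matrix.toEuclideanLin (cocycleMatrix α ν) f) =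
      Matrix.toEuclideanLin (cocycleMatrix α ν) (ProjRep.regular α g f) := by
  ext x
  simp only [ProjRep.regular_apply, Matrix.toLpLin_apply, Matrix.mulVec, dotProduct,
    cocycleMatrix, Matrix.of_apply, Finset.mul_sum]
  conv_rhs => rw [← Equiv.sum_comp (Equiv.mulLeft g)]
  refine Finset.sum_congr rfl fun k _ => ?_
  have := hα.mul_rule g (g⁻¹ * x) (x⁻¹ * g * k)
  have h2 : g⁻¹ * x * (x⁻¹ * g * k) = k := by group
  rw [mul_inv_cancel_left, h2] at this
  simp only [Equiv.coe_mulLeft, mul_inv_rev, inv_inv, inv_mul_cancel_left, ← mul_assoc x⁻¹]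
  have e1 := hα.ne_zero x (x⁻¹ * g * k)
  have e2 := hα.ne_zero (g⁻¹ * x) (x⁻¹ * g * k)
  field_simp
  linear_combination (ν (x⁻¹ * g * k) * f k) * this

lemma isGramianOfTightFrame_of_isStarProjection (hα : IsUnitaryCocycle α) {ν : G → ℂ}
    (h0 : cocycleMatrix α ν ≠ 0) (hP : IsStarProjection (cocycleMatrix α ν)) :
    IsGramianOfTightFrame α (cocycleMatrix α ν) := by
  classical
  set P := cocycleMatrix α ν with hPdef
  let L : EuclideanSpace ℂ G →ₗ[ℂ] EuclideanSpace ℂ G := Matrix.toEuclideanLin P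
  have hLL (f) : L (L f) = L f := by
    ext x
    have : P *ᵥ (P *ᵥ f.ofLp) = P *ᵥ f.ofLp := by
      rw [Matrix.mulVec_mulVec, hP.isIdempotentElem.eq]
    exact congrFun this x
  have hLsymm (f f') : ⟪L f, f'⟫_ℂ = ⟪f, L f'⟫_ℂ :=
    (Matrix.isSymmetric_toEuclideanLin_iff.2 hP.isSelfAdjoint) f f'
  let e (g : G) : EuclideanSpace ℂ G := EuclideanSpace.single g 1
  have hPe (g h : G) : ⟪e g, L (e h)⟫_ℂ = P g h := by
    simp [e, L, EuclideanSpace.inner_single_left, Matrix.toLpLin_apply]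
  let W : Submodule ℂ (EuclideanSpace ℂ G) := LinearMap.range L
  have hLW (f) (hf : f ∈ W) : L f = f := by
    obtain ⟨f, rfl⟩ := hf
    exact hLL f
  have hinv (g : G) : ∀ f ∈ W, ProjRep.regular α g f ∈ W := by
    rintro _ ⟨f, rfl⟩
    exact ⟨_, (regular_toEuclideanLin_cocycleMatrix hα ν g f).symm⟩
  let S : G → W →ₗ[ℂ] W := fun g => (ProjRep.regular α g).restrict (hinv g)
  have hS : ∀ g h x, S g (S h x) = α g h • S (g * h) x := fun g h x =>
    Subtype.ext (ProjRep.regular_regular hα g h x)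
  have hSiso : ∀ g (x y : W), ⟪S g x, S g y⟫_ℂ = ⟪x, y⟫_ℂ := fun g x y =>
    ProjRep.inner_regular hα g x y
  have hS1 := ProjRep.apply_one_of_isometry (E := W) hS hSiso
  let b := stdOrthonormalBasis ℂ W
  -- The scalar offsets the `α 1 1` in `regular_single_one`, so the orbit of `w` is exactly `L (e
  -- g)`.
  let w : W := ⟨(α 1 1)⁻¹ • L (e 1), W.smul_mem _ ⟨_, rfl⟩⟩
  have hSw (g : G) : ((S g w : W) : EuclideanSpace ℂ G) = L (e g) := by
    change ProjRep.regular α g ((α 1 1)⁻¹ • L (e 1)) = _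
    rw [map_smul, regular_toEuclideanLin_cocycleMatrix hα, ProjRep.regular_single_one hα,
      map_smul, inv_smul_smul₀ (hα.ne_zero 1 1)]
  have horbit (g : G) :
      (ProjRep.ofBasis hα b.toBasis S hS hS1).orbit (b.repr w) g = b.repr (S g w) := by
    have := ProjRep.ofBasis_mat_mulVec hα b.toBasis S hS hS1 g w
    ext i
    exact congrFun this i
  refine ⟨ProjRep.ofBasis hα b.toBasis S hS hS1, b.repr w,
    ProjRep.ofBasis_isUnitary hα b S hS hS1 hSiso, fun hw => h0 ?_, fun f => ?_, ?_⟩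
  · have hw0 : w = 0 := (LinearIsometryEquiv.map_eq_zero_iff b.repr).1 hw
    ext g h
    rw [← hPe, ← hSw, hw0]
    simp
  · obtain ⟨f, rfl⟩ := b.repr.surjective f
    simp only [horbit]
    -- Apply `L` to the expansion of `f` in the standard basis; `L` fixes `f` and is symmetric.
    have : f = ∑ g, ⟪S g w, f⟫_ℂ • S g w := by
      apply Subtype.ext
      simp only [Submodule.coe_inner, hSw, Submodule.coe_sum, Submodule.coe_smul]
      conv_lhs => 
        rw [← hLW f f.2, ← (EuclideanSpace.basisFun G ℂ).sum_repr' (f : EuclideanSpace ℂ G),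
          map_sum]
      refine Finset.sum_congr rfl fun g _ => ?_
      rw [map_smul, hLsymm, hLW f f.2, EuclideanSpace.basisFun_apply]
    conv_lhs => rw [this, map_sum]
    refine Finset.sum_congr rfl fun g _ => ?_
    rw [map_smul]
    congr 1
    exact (b.repr.inner_map_map _ _).symm
  · ext g h
    rw [Matrix.gram_apply, horbit, horbit]
    refine Eq.trans ?_ (b.repr.inner_map_map _ _).symm
    rw [Submodule.coe_inner, hSw, hSw, hLsymm, hLL, hPe]

end Gramian

theorem mainTheorem5 {G : Type*} [Group G] [Fintype G] (α : G → G → ℂ)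
    (hα : IsUnitaryCocycle α) (R : Set (ProjRep α)) (hR : ProjRep.IsCompleteSet R)
    (hRu : ∀ ρ ∈ R, ρ.IsUnitary) (ν : G → ℂ) :
    (IsGramianOfTightFrame α (cocycleMatrix α ν) ↔
      cocycleMatrix α ν ≠ 0 ∧ IsStarProjection (cocycleMatrix α ν)) ∧
    (IsStarProjection (cocycleMatrix α ν) ↔
      ∀ ρ ∈ R, IsStarProjection (ρ.fourier ν)) := by
  refine ⟨⟨fun h => ⟨h.ne_zero, ?_⟩, fun h => isGramianOfTightFrame_of_isStarProjection hα h.1 h.2⟩,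
    ?_⟩
  · obtain ⟨ρ, v, -, -, hφ, hP⟩ := h
    rw [hP]
    exact hφ.isStarProjection_gram
  · rw [isStarProjection_cocycleMatrix_iff hα, forall_isStarProjection_fourier_iff hα hR hRu]
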